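/- \textbf{Conventions.} A \emph{topological cylindric algebra of dimension $\omega$} is a Boolean algebra $A$ with unary operations $c_i$ and $I_i$ and constants $d_{ij}$ ($i,j<\omega$) such that, writing $q_ix=-c_i(-x)$, $s^i_jx=c_i(d_{ij}\cdot x)$, $p\leftrightarrow q=(-p+q)\cdot(-q+p)$ and $\Delta x=\{i<\omega: c_ix\neq x\}$, the following hold for all $x,y,p,q\in A$ and all $i,j,k<\omega$: \begin{itemize} \item (cylindric axioms) $c_i0=0$; $x\le c_ix$; $c_i(x\cdot c_iy)=c_ix\cdot c_iy$; $c_ic_jx=c_jc_ix$; $d_{ii}=1$; $d_{ij}=c_k(d_{ik}\cdot d_{jk})$ if $k\ne i,j$; $c_i(d_{ij}\cdot x)\cdot c_i(d_{ij}\cdot -x)=0$ if $i\neq j$; \item (interior axioms) $q_i(p\leftrightarrow q)\le q_i(I_ip\leftrightarrow I_iq)$; $I_ip\le p$; $I_ip\cdot I_iq=I_i(p\cdot q)$; $I_ip\le I_iI_ip$; $I_i1=1$; $c_kI_ip=I_ip$ if $k\ne i$ and $k\notin\Delta p$; $s^i_jI_ip=I_js^i_jp$ if $j\notin\Delta p$.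 \end{itemize} Such an algebra $A$ belongs to $\mathsf{TLf}_\omega$ (is \emph{locally finite}) if $\Delta x$ is finite for every $x\in A$. It is \emph{simple} if it has at least two elements and its only congruences (for all operations, including the $I_i$) are equality and $A\times A$. For $n<\omega$, $\mathrm{Nr}_nA$ is the Boolean subalgebra $\{x\in A:\Delta x\subseteq n\}$, where $n=\{0,\dots,n-1\}$, and $A$ is \emph{neatly atomic} if every $\mathrm{Nr}_nA$, $n<\omega$, is an atomic Boolean algebra. A \emph{finitary type} is a set $Y\subseteq \mathrm{Nr}_nA$ for some $n<\omega$; it is \emph{non-principal} if its infimum in $A$ is $0$. For a topological space $U$, the full topological cylindric set algebra with base $U$ is the Boolean algebra of all subsets of ${}^\omega U$ with $c_iX=\{s:\exists t\in X\ \forall j\neq i\ (t_j=s_j)\}$, $d_{ij}=\{s:s_i=s_j\}$ and $I_iX=\{s: s_i\in\mathrm{int}\{a\in U:s^i_a\in X\}\}$, where $s^i_a$ is $s$ with its $i$-th entry replaced by $a$. A \emph{set algebra} with base $U$ is a subalgebra $B$ of it, a \emph{representation} of $A$ with base $U$ is an isomorphism $f:A\to B$ (for all the operations, including the $I_i$)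 onto a set algebra $B$ with base $U$, and $f$ is an \emph{atomic representation} if $\bigcup\{f(x): x \text{ an atom of } \mathrm{Nr}_nA\}={}^\omega U$ for every $n<\omega$. It \emph{omits} $Y\subseteq A$ if $\bigcap_{y\in Y}f(y)=\emptyset$. \textbf{Theorem.} Let $A\in\mathsf{TLf}_\omega$ be countable, simple and neatly atomic. Then $A$ has an atomic representation, with a non-empty base. Moreover, every atomic representation of $A$ omits every non-principal finitary type of $A$. -/

import Mathlib

/-- A cylindric algebra with dimensions indexed by `α`: a Boolean algebra with cylindrifications
`cyl i` and diagonal elements `diag i j`. -/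
class CylindricAlgebra (α : Type*) (A : Type*) [BooleanAlgebra A] where
  cyl : α → A → A
  diag : α → α → A
  cyl_bot : ∀ i, cyl i ⊥ = ⊥
  le_cyl : ∀ i x, x ≤ cyl i x
  cyl_inf_cyl : ∀ i x y, cyl i (x ⊓ cyl i y) = cyl i x ⊓ cyl i y
  cyl_comm : ∀ i j x, cyl i (cyl j x) = cyl j (cyl i x)
  diag_self : ∀ i, diag i i = ⊤
  diag_eq_cyl : ∀ i j k, k ≠ i → k ≠ j → diag i j = cyl k (diag i k ⊓ diag j k)
  cyl_diag_inf : ∀ i j x, i ≠ j → cyl i (diag i j ⊓ x) ⊓ cyl i (diag i j ⊓ xᶜ) = ⊥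

namespace CylindricAlgebra

variable {α A : Type*} [BooleanAlgebra A] [CylindricAlgebra α A]

/-- The universal quantifier `qᵢ x = - cᵢ (- x)`. -/
def univ (i : α) (x : A) : A := (cyl i xᶜ)ᶜ

/-- The substitution replacing the index `i` by the index `j`. -/
def subst (i j : α) (x : A) : A := cyl i (diag i j ⊓ x)

/-- The dimension set `Δ x`. -/
def dimSet (α : Type*) {A : Type*} [BooleanAlgebra A] [CylindricAlgebra α A] (x : A) : Set α :=
  {i | cyl i x ≠ x}

end CylindricAlgebra

/-- A topological cylindric algebra with dimensions indexed by `α`: a cylindric algebra with an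
interior operator `int i` for every index `i`. The meet `(pᶜ ⊔ q) ⊓ (qᶜ ⊔ p)` occurring in the
first axiom is the Boolean biconditional. -/
class TopCylindricAlgebra (α : Type*) (A : Type*) [BooleanAlgebra A]
    extends CylindricAlgebra α A where
  int : α → A → A
  univ_iff_le : ∀ i p q,
    CylindricAlgebra.univ i ((pᶜ ⊔ q) ⊓ (qᶜ ⊔ p)) ≤
      CylindricAlgebra.univ i (((int i p)ᶜ ⊔ int i q) ⊓ ((int i q)ᶜ ⊔ int i p))
  int_le : ∀ i p, int i p ≤ p
  int_inf : ∀ i p q, int i p ⊓ int i q = int i (p ⊓ q)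
  int_le_int_int : ∀ i p, int i p ≤ int i (int i p)
  int_top : ∀ i, int i ⊤ = ⊤
  cyl_int : ∀ i k p, k ≠ i → k ∉ CylindricAlgebra.dimSet α p → cyl k (int i p) = int i p
  subst_int : ∀ i j p, j ∉ CylindricAlgebra.dimSet α p →
    CylindricAlgebra.subst i j (int i p) = int j (CylindricAlgebra.subst i j p)

namespace TopCylindricAlgebra

open CylindricAlgebra

section Abstract

variable (α : Type*) {A B : Type*} [BooleanAlgebra A] [BooleanAlgebra B]
  [TopCylindricAlgebra α A] [TopCylindricAlgebra α B]

/-- Homomorphisms of topological cylindric algebras. -/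
structure IsHom (f : A → B) : Prop where
  map_sup : ∀ x y, f (x ⊔ y) = f x ⊔ f y
  map_inf : ∀ x y, f (x ⊓ y) = f x ⊓ f y
  map_compl : ∀ x, f xᶜ = (f x)ᶜ
  map_bot : f ⊥ = ⊥
  map_top : f ⊤ = ⊤
  map_cyl : ∀ (i : α) x, f (cyl i x) = cyl i (f x)
  map_diag : ∀ i j : α, f (diag i j) = diag i j
  map_int : ∀ (i : α) x, f (int i x) = int i (f x)

/-- Congruence relations of topological cylindric algebras. -/
structure IsCongruence (r : Setoid A) : Prop where
  sup : ∀ {x x' y y'}, r x x' → r y y' → r (x ⊔ y) (x' ⊔ y')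
  inf : ∀ {x x' y y'}, r x x' → r y y' → r (x ⊓ y) (x' ⊓ y')
  compl : ∀ {x x'}, r x x' → r xᶜ x'ᶜ
  cyl : ∀ (i : α) {x x'}, r x x' → r (cyl i x) (cyl i x')
  int : ∀ (i : α) {x x'}, r x x' → r (int i x) (int i x')

variable (A)

/-- The algebra is nontrivial and its only congruences are equality and the total relation. -/
def IsSimple : Prop :=
  Nontrivial A ∧ ∀ r : Setoid A, IsCongruence α r → r = ⊥ ∨ r = ⊤

/-- Every element has a finite dimension set. -/
def IsLocallyFinite : Prop := ∀ x : A, (dimSet α x).Finite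

end Abstract

section Neat

theorem cyl_compl_eq {α A : Type*} [BooleanAlgebra A] [CylindricAlgebra α A] {i : α} {x : A}
    (h : cyl i x = x) : cyl i xᶜ = xᶜ := by
  apply le_antisymm _ (le_cyl i _)
  have := cyl_inf_cyl i xᶜ x
  rw [h, compl_inf_eq_bot, cyl_bot] at this
  exact le_compl_iff_disjoint_right.2 (disjoint_iff.2 this.symm)

theorem cyl_inf_eq {α A : Type*} [BooleanAlgebra A] [CylindricAlgebra α A] {i : α} {x y : A}
    (hx : cyl i x = x) (hy : cyl i y = y) : cyl i (x ⊓ y) = x ⊓ y := by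
  have := cyl_inf_cyl i x y
  rwa [hx, hy] at this

theorem cyl_sup_eq {α A : Type*} [BooleanAlgebra A] [CylindricAlgebra α A] {i : α} {x y : A}
    (hx : cyl i x = x) (hy : cyl i y = y) : cyl i (x ⊔ y) = x ⊔ y := by
  have := cyl_compl_eq (cyl_inf_eq (cyl_compl_eq hx) (cyl_compl_eq hy))
  simpa using this

/-- The Boolean algebra of the neat `n`-reduct of an `ω`-dimensional algebra: the elements whose
dimension set is contained in `n = {0, …, n - 1}`. -/
def neatReduct (A : Type*) [BooleanAlgebra A] [TopCylindricAlgebra ℕ A] (n : ℕ) :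
    BooleanSubalgebra A where
  carrier := {a | dimSet ℕ a ⊆ Set.Iio n}
  supClosed' x hx y hy i hi := by
    by_contra hn
    exact hi (cyl_sup_eq (not_not.1 fun h => hn (hx h)) (not_not.1 fun h => hn (hy h)))
  infClosed' x hx y hy i hi := by
    by_contra hn
    exact hi (cyl_inf_eq (not_not.1 fun h => hn (hx h)) (not_not.1 fun h => hn (hy h)))
  compl_mem' {x} hx i hi := by
    by_contra hn
    exact hi (cyl_compl_eq (not_not.1 fun h => hn (hx h)))
  bot_mem' i hi := absurd (cyl_bot i) hi

variable (A : Type*) [BooleanAlgebra A] [TopCylindricAlgebra ℕ A]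

/-- All neat reducts with finitely many dimensions are atomic. -/
def IsNeatlyAtomic : Prop := ∀ n : ℕ, IsAtomic (neatReduct A n)

variable {A}

/-- A finitary type is a subset of some neat `n`-reduct, `n` finite. -/
def IsFinitaryType (Y : Set A) : Prop := ∃ n : ℕ, Y ⊆ neatReduct A n

/-- `Y` is non-principal if its infimum is zero. -/
def IsNonPrincipal (Y : Set A) : Prop := IsGLB Y ⊥

end Neat

section Concrete

variable {α U : Type*}

/-- The concrete cylindrification: all sequences that agree off `i` with a member of `X`. -/
def setCyl (i : α) (X : Set (α → U)) : Set (α → U) := {s | ∃ t ∈ X, ∀ j, j ≠ i → t j = s j}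

theorem mem_setCyl [DecidableEq α] {i : α} {X : Set (α → U)} {s : α → U} :
    s ∈ setCyl i X ↔ ∃ a, Function.update s i a ∈ X := by
  constructor
  · rintro ⟨t, ht, h⟩
    refine ⟨t i, ?_⟩
    have : Function.update s i (t i) = t := by
      funext j
      by_cases hj : j = i
      · subst hj; simp
      · simp [hj, h j hj]
    rwa [this]
  · rintro ⟨a, ha⟩
    exact ⟨_, ha, fun j hj => by simp [hj]⟩

theorem update_mem_iff [DecidableEq α] {i : α} {X : Set (α → U)} (h : setCyl i X = X)
    (s : α → U) (a : U) : Function.update s i a ∈ X ↔ s ∈ X := by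
  constructor
  · intro ha
    rw [← h]
    exact mem_setCyl.2 ⟨a, ha⟩
  · intro hs
    rw [← h]
    exact mem_setCyl.2 ⟨s i, by simpa using hs⟩

/-- The full cylindric set algebra with unit `α → U`. -/
instance fullCylindricSetAlgebra [DecidableEq α] : CylindricAlgebra α (Set (α → U)) where
  cyl := setCyl
  diag i j := {s | s i = s j}
  cyl_bot i := by
    ext s
    simp [setCyl]
  le_cyl i X s hs := ⟨s, hs, fun _ _ => rfl⟩
  cyl_inf_cyl i X Y := by
    ext s
    simp only [mem_setCyl, Set.inf_eq_inter, Set.mem_inter_iff, Function.update_idem]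
    exact exists_and_right
  cyl_comm i j X := by
    ext s
    by_cases h : i = j
    · rw [h]
    · simp only [mem_setCyl]
      rw [exists_comm]
      simp only [Function.update_comm h]
  diag_self i := by
    ext s
    simp
  diag_eq_cyl i j k hi hj := by
    ext s
    simp [mem_setCyl, hi.symm, hj.symm, eq_comm]
  cyl_diag_inf i j X h := by
    ext s
    simp only [Set.inf_eq_inter, Set.mem_inter_iff, mem_setCyl, Set.mem_ofPred_eq,
      Function.update_self, Function.update_of_ne (Ne.symm h), Set.mem_compl_iff,
      Set.bot_eq_empty, Set.mem_empty_iff_false, iff_false]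
    rintro ⟨⟨a, rfl, ha⟩, ⟨b, hb, hb'⟩⟩
    exact hb' (hb ▸ ha)

/-- The concrete interior operator: `s` belongs to `Iᵢ X` when `s i` is an interior point of the
`i`-th section of `X` through `s`. -/
def setInt [DecidableEq α] [TopologicalSpace U] (i : α) (X : Set (α → U)) : Set (α → U) :=
  {s | s i ∈ interior {a | Function.update s i a ∈ X}}

theorem mem_setInt [DecidableEq α] [TopologicalSpace U] {i : α} {X : Set (α → U)} {s : α → U} :
    s ∈ setInt i X ↔ s i ∈ interior {a | Function.update s i a ∈ X} := Iff.rfl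

/-- The full topological cylindric set algebra with unit `α → U`, for a topological space `U`. -/
instance fullSetAlgebra [DecidableEq α] [TopologicalSpace U] :
    TopCylindricAlgebra α (Set (α → U)) where
  int := setInt
  univ_iff_le i p q := by
    intro s hs hs'
    have hs : ¬ s ∈ setCyl i (((pᶜ ⊔ q) ⊓ (qᶜ ⊔ p))ᶜ) := hs
    apply hs
    have hs' : s ∈ setCyl i _ := hs'
    rw [mem_setCyl] at hs hs' ⊢
    by_contra hc
    obtain ⟨a, ha⟩ := hs'
    apply ha
    have key : ∀ b, Function.update s i b ∈ p ↔ Function.update s i b ∈ q := by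
      intro b
      by_contra hb
      refine hc ⟨b, fun hb' => hb ?_⟩
      simp only [Set.inf_eq_inter, Set.sup_eq_union, Set.mem_inter_iff, Set.mem_union,
        Set.mem_compl_iff] at hb'
      tauto
    have key2 : Function.update s i a ∈ setInt i p ↔ Function.update s i a ∈ setInt i q := by
      simp only [mem_setInt, Function.update_idem, key]
    simp only [Set.inf_eq_inter, Set.sup_eq_union, Set.mem_inter_iff, Set.mem_union,
        Set.mem_compl_iff]
    tauto
  int_le i p s hs := by
    have := interior_subset hs
    simpa using this
  int_inf i p q := by
    ext s
    simp only [Set.inf_eq_inter, Set.mem_inter_iff, mem_setInt]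
    rw [← Set.mem_inter_iff, ← interior_inter]
    rfl
  int_le_int_int i p s hs := by
    rw [mem_setInt] at hs ⊢
    simpa only [mem_setInt, Function.update_idem, Function.update_self, Set.ofPred_mem_eq,
      interior_interior] using hs
  int_top i := by
    ext s
    simp [mem_setInt]
  cyl_int i k p h hk := by
    have hk : setCyl k p = p := not_not.1 hk
    change setCyl k (setInt i p) = setInt i p
    ext s
    simp only [mem_setCyl, mem_setInt, Function.update_of_ne h.symm]
    have : ∀ a b, Function.update (Function.update s k a) i b ∈ p ↔ Function.update s i b ∈ p := by
      intro a b
      rw [Function.update_comm h, update_mem_iff hk]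
    simp only [this]
    exact ⟨fun ⟨_, h⟩ => h, fun h => ⟨s k, h⟩⟩
  subst_int i j p hj := by
    have hj : setCyl j p = p := not_not.1 hj
    change setCyl i ({s | s i = s j} ⊓ setInt i p) = setInt j (setCyl i ({s | s i = s j} ⊓ p))
    ext s
    by_cases h : i = j
    · subst h
      have h1 : setInt i p = p := by
        ext t
        simp only [mem_setInt, update_mem_iff hj]
        by_cases ht : t ∈ p <;> simp [ht]
      have h2 : ({s : α → U | s i = s i} ⊓ p) = p := by ext t; simp
      rw [h1, h2, hj, h1]
    · have hji : j ≠ i := Ne.symm h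
      have h1 : ∀ t : α → U, t ∈ setCyl i ({s | s i = s j} ⊓ p) ↔
          Function.update t i (t j) ∈ p := by
        intro t
        simp [mem_setCyl, Function.update_of_ne hji]
      have h2 : ∀ a, Function.update (Function.update s j a) i a ∈ p ↔
          Function.update s i a ∈ p := by
        intro a
        rw [Function.update_comm hji, update_mem_iff hj]
      simp only [mem_setInt, h1, Function.update_self, h2]
      simp [mem_setCyl, mem_setInt, Function.update_of_ne hji]

variable (α U) in
/-- A topological cylindric set algebra with base `U`: a subalgebra of the full one. -/
structure SetAlgebra [DecidableEq α] [TopologicalSpace U]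
    extends BooleanSubalgebra (Set (α → U)) where
  cyl_mem : ∀ (i : α) {X}, X ∈ carrier → cyl i X ∈ carrier
  diag_mem : ∀ i j : α, diag i j ∈ carrier
  int_mem : ∀ (i : α) {X}, X ∈ carrier → int i X ∈ carrier

variable {A : Type*} [BooleanAlgebra A] [TopologicalSpace U]

/-- `f` is an isomorphism of `A` onto the set algebra `B`. -/
structure IsRepresentation [DecidableEq α] [TopCylindricAlgebra α A] (B : SetAlgebra α U)
    (f : A → Set (α → U)) : Prop where
  isHom : IsHom α f
  injective : Function.Injective f
  range_eq : Set.range f = B.carrier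

/-- A representation is atomic if for every `n` the images of the atoms of the neat `n`-reduct
cover the unit. -/
structure IsAtomicRepresentation [TopCylindricAlgebra ℕ A] (B : SetAlgebra ℕ U)
    (f : A → Set (ℕ → U)) : Prop extends IsRepresentation B f where
  iUnion_atoms : ∀ n : ℕ, ⋃ x ∈ {x : neatReduct A n | IsAtom x}, f x = Set.univ

/-- `f` omits `Y` if the images of the elements of `Y` have empty intersection. -/
def Omits (f : A → Set (α → U)) (Y : Set A) : Prop := ⋂ y ∈ Y, f y = ∅

end Concrete

end TopCylindricAlgebra

/-! The existence half is a Henkin construction carried out inside `A`. Local finiteness leaves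
infinitely many indices free of any given element, and these serve as constants. A Rasiowa–Sikorski
argument (`exists_generic_filter`, `exists_isHenkin`) meets countably many dense sets and yields an
ultrafilter `F` that contains witnesses for its existential elements and, for each clash-free
assignment of names to the first `n` coordinates, the translate of some atom of the neat `n`-reduct.

The points are the indices modulo `diag i j ∈ F`. A sequence `s` satisfies `x` when the element
obtained from `x` by replacing its coordinates by names of the entries of `s` lies in `F`. Names are
taken outside the coordinates being replaced, so that simultaneous substitution is a product of
single ones; `mem_rep_iff` makes the choice of names immaterial. Witnesses in `F` give the
cylindrifications.

The topology is generated by the sets that elements `int i z` define. That `int` is then the true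
interior rests on `openSet_subset`: inclusion of a basic open set in a definable set is itself
expressed by an element of `F`, and the first interior axiom turns it into inclusion in the
definable interior. Simplicity gives injectivity, and the atoms met by `F` give atomicity.

For omission, an atom of the neat reduct whose image shares a point with the image of every member
of `Y` lies below all of `Y`, hence below its infimum `⊥`. -/

namespace CylindricAlgebra

/-! ### Arithmetic of cylindrifications. -/

variable {α A : Type*} [BooleanAlgebra A] [CylindricAlgebra α A] {i j k : α} {x y z : A}

theorem cyl_top (i : α) : cyl i (⊤ : A) = ⊤ := top_le_iff.1 (le_cyl i _)

theorem cyl_cyl (i : α) (x : A) : cyl i (cyl i x) = cyl i x := by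
  simpa [cyl_top] using cyl_inf_cyl i ⊤ x

theorem cyl_inf_of_right (x : A) (hy : cyl i y = y) : cyl i (x ⊓ y) = cyl i x ⊓ y := by
  simpa [hy] using cyl_inf_cyl i x y

theorem cyl_inf_of_left (hx : cyl i x = x) (y : A) : cyl i (x ⊓ y) = x ⊓ cyl i y := by
  rw [inf_comm, cyl_inf_of_right y hx, inf_comm]

theorem cyl_mono (i : α) (h : x ≤ y) : cyl i x ≤ cyl i y := by
  have h1 : x ⊓ cyl i y = x := inf_eq_left.2 (h.trans (le_cyl i y))
  have h2 := cyl_inf_cyl i x y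
  rw [h1] at h2
  rw [h2]
  exact inf_le_right

theorem cyl_le_iff (hy : cyl i y = y) : cyl i x ≤ y ↔ x ≤ y :=
  ⟨(le_cyl i x).trans, fun h => hy ▸ cyl_mono i h⟩

theorem cyl_cyl_eq (j : α) (hx : cyl i x = x) : cyl i (cyl j x) = cyl j x := by
  rw [cyl_comm, hx]

theorem univ_le (i : α) (x : A) : univ i x ≤ x := by
  have := compl_le_compl (le_cyl i xᶜ)
  rwa [compl_compl] at this

theorem le_univ_iff (hx : cyl i x = x) : x ≤ univ i y ↔ x ≤ y := by
  rw [univ, le_compl_comm, cyl_le_iff (TopCylindricAlgebra.cyl_compl_eq hx), compl_le_compl_iff_le]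

theorem cyl_univ (i : α) (x : A) : cyl i (univ i x) = univ i x :=
  TopCylindricAlgebra.cyl_compl_eq (cyl_cyl i _)

theorem cyl_diag_of_ne (hi : k ≠ i) (hj : k ≠ j) : cyl k (diag i j : A) = diag i j := by
  rw [diag_eq_cyl i j k hi hj, cyl_cyl]

/-! ### Diagonal elements and single substitutions. -/

section Infinite

set_option linter.unusedSectionVars false

variable [Infinite α]

theorem diag_comm (i j : α) : (diag i j : A) = diag j i := by
  classical
  obtain ⟨k, hk⟩ := Infinite.exists_notMem_finset ({i, j} : Finset α)
  simp only [Finset.mem_insert, Finset.mem_singleton, not_or] at hk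
  rw [diag_eq_cyl i j k hk.1 hk.2, inf_comm, ← diag_eq_cyl j i k hk.2 hk.1]

theorem cyl_diag (h : i ≠ j) : cyl i (diag i j : A) = ⊤ := by
  have := diag_eq_cyl (A := A) j j i h h
  rw [diag_self, inf_idem] at this
  rw [diag_comm, this]

theorem diag_trans (i j k : α) : (diag i j ⊓ diag j k : A) ≤ diag i k := by
  by_cases h : j = i
  · subst h
    exact inf_le_right
  by_cases h' : j = k
  · subst h'
    exact inf_le_left
  rw [diag_eq_cyl i k j h h', diag_comm j k]
  exact le_cyl j _

/-- An element is determined by its meet with `diag i j` if it does not depend on `i`. -/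
theorem le_of_inf_diag_le (h : i ≠ j) (hx : cyl i x = x) (hy : cyl i y = y)
    (hxy : x ⊓ diag i j ≤ y) : x ≤ y := by
  have := cyl_mono i hxy
  rwa [cyl_inf_of_left hx, cyl_diag h, inf_top_eq, hy] at this

theorem eq_of_inf_diag_eq (h : i ≠ j) (hx : cyl i x = x) (hy : cyl i y = y)
    (hxy : x ⊓ diag i j = y ⊓ diag i j) : x = y :=
  le_antisymm (le_of_inf_diag_le h hx hy (hxy.le.trans inf_le_left))
    (le_of_inf_diag_le h hy hx (hxy.ge.trans inf_le_left))

/-- Together with `eq_of_inf_diag_eq` this characterises `subst i j x` as the unique element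
independent of `i` that agrees with `x` on the diagonal. The substitution identities below are
proved from this uniqueness. -/
theorem subst_inf_diag (h : i ≠ j) (x : A) : subst i j x ⊓ diag i j = x ⊓ diag i j := by
  apply le_antisymm
  · refine le_inf ?_ inf_le_right
    have h1 := cyl_diag_inf i j x h
    rw [subst, ← disjoint_compl_right_iff, disjoint_iff, ← le_bot_iff, ← h1, inf_assoc]
    exact inf_le_inf_left _ (le_cyl i _)
  · exact le_inf (by rw [subst, inf_comm]; exact le_cyl i _) inf_le_right

theorem cyl_subst (i j : α) (x : A) : cyl i (subst i j x) = subst i j x := cyl_cyl i _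

theorem cyl_subst_of_ne (hi : k ≠ i) (hj : k ≠ j) (hx : cyl k x = x) :
    cyl k (subst i j x) = subst i j x :=
  cyl_cyl_eq i (TopCylindricAlgebra.cyl_inf_eq (cyl_diag_of_ne hi hj) hx)

theorem subst_eq_self (h : i ≠ j) (hx : cyl i x = x) : subst i j x = x :=
  eq_of_inf_diag_eq h (cyl_subst i j x) hx (subst_inf_diag h x)

theorem subst_inf (h : i ≠ j) (x y : A) : subst i j (x ⊓ y) = subst i j x ⊓ subst i j y := by
  refine eq_of_inf_diag_eq h (cyl_subst i j _)
    (TopCylindricAlgebra.cyl_inf_eq (cyl_subst i j x) (cyl_subst i j y)) ?_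
  rw [subst_inf_diag h, inf_inf_distrib_right, inf_inf_distrib_right _ _ (diag i j),
    subst_inf_diag h, subst_inf_diag h]

theorem inf_diag_compl_congr (d : A) (h : x ⊓ d = y ⊓ d) : xᶜ ⊓ d = yᶜ ⊓ d := by
  have key : ∀ u : A, uᶜ ⊓ d = (u ⊓ d)ᶜ ⊓ d := fun u => by
    rw [compl_inf, inf_sup_right, compl_inf_eq_bot, sup_bot_eq]
  rw [key x, key y, h]

theorem subst_compl (h : i ≠ j) (x : A) : subst i j xᶜ = (subst i j x)ᶜ := by
  refine eq_of_inf_diag_eq h (cyl_subst i j _)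
    (TopCylindricAlgebra.cyl_compl_eq (cyl_subst i j x)) ?_
  rw [subst_inf_diag h]
  exact (inf_diag_compl_congr _ (subst_inf_diag h x)).symm

theorem subst_mono (i j : α) (h : x ≤ y) : subst i j x ≤ subst i j y :=
  cyl_mono i (inf_le_inf_left _ h)

theorem subst_le_cyl (i j : α) (x : A) : subst i j x ≤ cyl i x := cyl_mono i inf_le_right

theorem subst_top (h : i ≠ j) : subst i j (⊤ : A) = ⊤ := subst_eq_self h (cyl_top i)

theorem subst_subst (hij : i ≠ j) (hik : i ≠ k) (hjk : j ≠ k) (hx : cyl j x = x) :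
    subst j k (subst i j x) = subst i k x := by
  refine eq_of_inf_diag_eq hjk (cyl_subst j k _) (cyl_subst_of_ne hij.symm hjk hx) ?_
  rw [subst_inf_diag hjk]
  have hd : cyl i (diag j k : A) = diag j k := cyl_diag_of_ne hij hik
  refine eq_of_inf_diag_eq hik (TopCylindricAlgebra.cyl_inf_eq (cyl_subst i j x) hd)
    (TopCylindricAlgebra.cyl_inf_eq (cyl_subst i k x) hd) ?_
  have h1 : (diag j k ⊓ diag i k : A) = diag i j ⊓ (diag j k ⊓ diag i k) := by
    refine (inf_eq_right.2 ?_).symm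
    rw [inf_comm, diag_comm j k]
    exact diag_trans i k j
  rw [inf_assoc, h1, ← inf_assoc, subst_inf_diag hij, inf_assoc, ← h1, inf_right_comm,
    subst_inf_diag hik, inf_assoc, inf_comm (diag i k)]

theorem subst_inf_diag_le (hi : i ≠ j) (hk : i ≠ k) (x : A) :
    subst i j x ⊓ diag j k ≤ subst i k x := by
  rw [subst, ← cyl_inf_of_right _ (cyl_diag_of_ne hi hk)]
  refine cyl_mono i (le_inf ?_ (inf_le_left.trans inf_le_right))
  exact le_trans (inf_le_inf_right _ inf_le_left) (diag_trans i j k)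

/-- If `j` does not occur in `a` and `x`, then `subst i j x` is disjoint from `a` only if
`cyl i x` is. -/
theorem inf_cyl_eq_bot_of_inf_subst_eq_bot {a : A} (h : i ≠ j) (ha : cyl j a = a)
    (hx : cyl j x = x) (hax : a ⊓ subst i j x = ⊥) : a ⊓ cyl i x = ⊥ := by
  have h1 : cyl j (subst i j x) = cyl i x := by
    rw [subst, cyl_comm, cyl_inf_of_right _ hx, diag_comm, cyl_diag h.symm, top_inf_eq]
  rw [← h1, ← cyl_inf_of_left ha, hax, cyl_bot]

/-! ### Translates: simultaneous substitutions whose targets avoid their sources. -/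

/-- The meet of the diagonal elements `diag i (τ i)` for `i` in `J`. -/
def diagInf (A : Type*) [BooleanAlgebra A] [CylindricAlgebra α A] (J : Finset α) (τ : α → α) : A :=
  J.inf fun i => diag i (τ i)

variable {J : Finset α} {τ : α → α}

theorem diagInf_insert [DecidableEq α] (i : α) (J : Finset α) (τ : α → α) :
    diagInf A (insert i J) τ = diag i (τ i) ⊓ diagInf A J τ := Finset.inf_insert

theorem diagInf_le (hi : i ∈ J) : diagInf A J τ ≤ diag i (τ i) := Finset.inf_le hi

theorem diagInf_anti {J K : Finset α} (h : J ⊆ K) (τ : α → α) : diagInf A K τ ≤ diagInf A J τ :=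
  Finset.inf_mono h

theorem diagInf_congr {σ : α → α} (h : ∀ i ∈ J, τ i = σ i) : diagInf A J τ = diagInf A J σ :=
  Finset.inf_congr rfl fun i hi => by rw [h i hi]

theorem cyl_diagInf (hi : i ∉ J) (hτ : ∀ j ∈ J, τ j ≠ i) :
    cyl i (diagInf A J τ) = diagInf A J τ := by
  classical
  induction J using Finset.induction_on with
  | empty => exact cyl_top i
  | insert j J hj ih =>
    rw [diagInf_insert]
    simp only [Finset.mem_insert, not_or] at hi
    exact TopCylindricAlgebra.cyl_inf_eq
      (cyl_diag_of_ne hi.1 (hτ j (Finset.mem_insert_self _ _)).symm)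
      (ih hi.2 fun k hk => hτ k (Finset.mem_insert_of_mem hk))

/-- As no target lies in `J`, each index of `J` occurs in only one of the diagonals, and
cylindrifying along it removes that factor. -/
theorem eq_bot_of_inf_diagInf_eq_bot (hτ : ∀ i ∈ J, τ i ∉ J) (hx : ∀ i ∈ J, cyl i x = x)
    (h : x ⊓ diagInf A J τ = ⊥) : x = ⊥ := by
  classical
  induction J using Finset.induction_on with
  | empty => simpa [diagInf] using h
  | insert j J hj ih =>
    simp only [Finset.mem_insert, forall_eq_or_imp, not_or] at hτ hx
    refine ih (fun i hi => (hτ.2 i hi).2) hx.2 ?_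
    rw [diagInf_insert, inf_left_comm, inf_comm] at h
    refine le_bot_iff.1 (le_of_inf_diag_le (fun h => hτ.1.1 h.symm) ?_ (cyl_bot j) h.le)
    exact TopCylindricAlgebra.cyl_inf_eq hx.1 (cyl_diagInf hj fun k hk => (hτ.2 k hk).1)

/-- `z` is a translate of `x` along `τ`: it does not depend on the indices in `J`, and agrees
with `x` where `s i = s (τ i)` for all `i` in `J`. -/
structure IsTranslate (J : Finset α) (τ : α → α) (x z : A) : Prop where
  cyl_eq : ∀ i ∈ J, cyl i z = z
  inf_eq : z ⊓ diagInf A J τ = x ⊓ diagInf A J τ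

theorem IsTranslate.compl (h : IsTranslate J τ x z) : IsTranslate J τ xᶜ zᶜ where
  cyl_eq i hi := TopCylindricAlgebra.cyl_compl_eq (h.cyl_eq i hi)
  inf_eq := inf_diag_compl_congr _ h.inf_eq

theorem IsTranslate.cyl (h : IsTranslate J τ x z) (hi : i ∉ J) (hτ : ∀ j ∈ J, τ j ≠ i) :
    IsTranslate J τ (cyl i x) (cyl i z) where
  cyl_eq j hj := cyl_cyl_eq i (h.cyl_eq j hj)
  inf_eq := by
    have hD := cyl_diagInf (A := A) hi hτ
    rw [← cyl_inf_of_right _ hD, h.inf_eq, cyl_inf_of_right _ hD]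

theorem IsTranslate.subst [DecidableEq α] (h : IsTranslate J τ x z) (hi : i ∉ J)
    (hk : k ∉ insert i J) : IsTranslate (insert i J) (Function.update τ i k) x (subst i k z) where
  cyl_eq j hj := by
    simp only [Finset.mem_insert, not_or] at hk hj
    obtain rfl | hj := hj
    · exact cyl_subst j k z
    · exact cyl_subst_of_ne (fun h' : j = i => hi (h' ▸ hj)) (fun h' : j = k => hk.2 (h' ▸ hj))
        (h.cyl_eq j hj)
  inf_eq := by
    have hD : diagInf A J (Function.update τ i k) = diagInf A J τ :=
      diagInf_congr fun j hj => Function.update_of_ne (fun h' : j = i => hi (h' ▸ hj)) _ _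
    have hik : i ≠ k := fun h => hk (h ▸ Finset.mem_insert_self _ _)
    rw [diagInf_insert, hD, Function.update_self, ← inf_assoc, subst_inf_diag hik,
      inf_right_comm, h.inf_eq, inf_right_comm, inf_assoc]

theorem IsTranslate.inf {x' z' : A} (h : IsTranslate J τ x z) (h' : IsTranslate J τ x' z') :
    IsTranslate J τ (x ⊓ x') (z ⊓ z') where
  cyl_eq i hi := TopCylindricAlgebra.cyl_inf_eq (h.cyl_eq i hi) (h'.cyl_eq i hi)
  inf_eq := by rw [inf_inf_distrib_right, h.inf_eq, h'.inf_eq, ← inf_inf_distrib_right]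

theorem IsTranslate.bot : IsTranslate J τ (⊥ : A) ⊥ := ⟨fun i _ => cyl_bot i, rfl⟩

theorem IsTranslate.congr {σ : α → α} (h : IsTranslate J τ x z) (hσ : ∀ i ∈ J, τ i = σ i) :
    IsTranslate J σ x z := ⟨h.cyl_eq, diagInf_congr (A := A) hσ ▸ h.inf_eq⟩

theorem IsTranslate.diag (hτ : ∀ i ∈ J, τ i ∉ J) (hi : i ∈ J) (hj : j ∈ J) :
    IsTranslate J τ (diag i j : A) (diag (τ i) (τ j)) where
  cyl_eq k hk := cyl_diag_of_ne (fun h : k = τ i => hτ i hi (h ▸ hk))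
    (fun h : k = τ j => hτ j hj (h ▸ hk))
  inf_eq := by
    have h1 := diagInf_le (A := A) (τ := τ) hi
    have h2 := diagInf_le (A := A) (τ := τ) hj
    apply le_antisymm
    · refine le_inf ?_ inf_le_right
      refine le_trans (le_inf (le_trans (le_inf (inf_le_right.trans h1) inf_le_left)
        (diag_trans i (τ i) (τ j))) (inf_le_right.trans h2)) ?_
      rw [diag_comm j]
      exact diag_trans i (τ j) j
    · refine le_inf ?_ inf_le_right
      refine le_trans (le_inf (le_trans (le_inf (inf_le_right.trans h1) inf_le_left) ?_)
        (inf_le_right.trans h2)) (diag_trans (τ i) j (τ j))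
      rw [diag_comm i (τ i)]
      exact diag_trans (τ i) i j

/-- Compose the single substitutions one index at a time. The second clause records that the only
new indices on which the result may depend are the targets. -/
theorem exists_isTranslate (hτ : ∀ i ∈ J, τ i ∉ J) (x : A) :
    ∃ z, IsTranslate J τ x z ∧
      ∀ k, (∀ i ∈ J, τ i ≠ k) → (k ∉ J → CylindricAlgebra.cyl k x = x) →
        CylindricAlgebra.cyl k z = z := by
  classical
  induction J using Finset.induction_on with
  | empty => exact ⟨x, ⟨by simp, rfl⟩, fun k _ h => h (Finset.notMem_empty k)⟩
  | insert j J hj ih =>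
    simp only [Finset.mem_insert, forall_eq_or_imp, not_or] at hτ
    obtain ⟨z, hz, hz'⟩ := ih fun i hi => (hτ.2 i hi).2
    have h1 := hz.subst (k := τ j) hj (by simpa using hτ.1)
    rw [Function.update_eq_self] at h1
    refine ⟨_, h1, fun k hk hx => ?_⟩
    simp only [Finset.mem_insert, forall_eq_or_imp, not_or] at hk hx
    by_cases hkj : k = j
    · subst hkj
      exact cyl_subst k _ z
    · exact cyl_subst_of_ne hkj (Ne.symm hk.1)
        (hz' k hk.2 fun h => hx ⟨hkj, h⟩)

end Infinite

/-- Take `b` to be `a` cylindrified along all of `K`. The last clause is the self-conjugacy of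
cylindrification. -/
theorem exists_cyl_closed (K : Finset α) (a : A) :
    ∃ b, a ≤ b ∧ (∀ k ∈ K, cyl k b = b) ∧ (∀ k : α, cyl k a = a → cyl k b = b) ∧
      ∀ y, (∀ k ∈ K, cyl k y = y) → a ⊓ y = ⊥ → b ⊓ y = ⊥ := by
  classical
  induction K using Finset.induction_on with
  | empty => exact ⟨a, le_rfl, by simp, fun _ h => h, fun _ _ h => h⟩
  | insert j K hj ih =>
    obtain ⟨b, h1, h2, h3, h4⟩ := ih
    refine ⟨cyl j b, h1.trans (le_cyl j b), ?_, fun k hk => cyl_cyl_eq j (h3 k hk), ?_⟩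
    · intro k hk
      obtain rfl | hk := Finset.mem_insert.1 hk
      · exact cyl_cyl k b
      · exact cyl_cyl_eq j (h2 k hk)
    · intro y hy hay
      rw [← cyl_inf_of_right b (hy j (Finset.mem_insert_self j K)),
        h4 y (fun k hk => hy k (Finset.mem_insert_of_mem hk)) hay, cyl_bot]

end CylindricAlgebra

/-! ### Generic filters and the Henkin ultrafilter. -/

namespace TopCylindricAlgebra

open CylindricAlgebra

/-- The Rasiowa–Sikorski lemma, read off in the order dual of the non-zero elements, where filters
are ideals and dense sets are cofinal. -/
theorem exists_generic_filter {A ι : Type*} [BooleanAlgebra A] [Nontrivial A] [Countable ι]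
    (D : ι → Set A) (hD : ∀ i a, a ≠ ⊥ → ∃ b ∈ D i, b ≠ ⊥ ∧ b ≤ a) :
    ∃ F : Set A, ⊥ ∉ F ∧ (∀ x ∈ F, ∀ y ∈ F, x ⊓ y ∈ F) ∧ (∀ x ∈ F, ∀ y, x ≤ y → y ∈ F) ∧
      ∀ i, ∃ b ∈ F, b ∈ D i := by
  have := Encodable.ofCountable ι
  let 𝒟 : ι → Order.Cofinal {a : A // a ≠ ⊥}ᵒᵈ := fun i =>
    { carrier := {a | (OrderDual.ofDual a).1 ∈ D i}
      isCofinal := fun a => by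
        obtain ⟨b, h1, h2, h3⟩ := hD i _ (OrderDual.ofDual a).2
        exact ⟨OrderDual.toDual ⟨b, h2⟩, h1, h3⟩ }
  let I := Order.idealOfCofinals (OrderDual.toDual ⟨⊤, top_ne_bot⟩) 𝒟
  refine ⟨{a | ∃ h : a ≠ ⊥, OrderDual.toDual ⟨a, h⟩ ∈ I}, fun ⟨h, _⟩ => h rfl, ?_, ?_, ?_⟩
  · rintro x ⟨hx, hxI⟩ y ⟨hy, hyI⟩
    obtain ⟨w, hw, hxw, hyw⟩ := I.directed _ hxI _ hyI
    have hle : (OrderDual.ofDual w).1 ≤ x ⊓ y := le_inf hxw hyw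
    have hne : x ⊓ y ≠ ⊥ := fun h => (OrderDual.ofDual w).2 (le_bot_iff.1 (hle.trans h.le))
    exact ⟨hne, I.lower (a := w) hle hw⟩
  · rintro x ⟨hx, hxI⟩ y hxy
    have hne : y ≠ ⊥ := fun h => hx (le_bot_iff.1 (h ▸ hxy))
    exact ⟨hne, I.lower (a := OrderDual.toDual ⟨x, hx⟩) hxy hxI⟩
  · intro i
    obtain ⟨w, hw, hwI⟩ := Order.cofinal_meets_idealOfCofinals
      (OrderDual.toDual ⟨⊤, top_ne_bot⟩) 𝒟 i
    exact ⟨(OrderDual.ofDual w).1, ⟨(OrderDual.ofDual w).2, hwI⟩, hw⟩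

variable {A : Type*} [BooleanAlgebra A] [TopCylindricAlgebra ℕ A]

/-- An ultrafilter in which every true existential statement `cyl i x` has witnesses outside any
given finite set. -/
structure IsHenkin (F : Set A) : Prop where
  bot_notMem : ⊥ ∉ F
  inf_mem : ∀ {x y}, x ∈ F → y ∈ F → x ⊓ y ∈ F
  mem_of_le : ∀ {x y}, x ∈ F → x ≤ y → y ∈ F
  mem_or_compl_mem : ∀ x, x ∈ F ∨ xᶜ ∈ F
  exists_subst_mem : ∀ (i : ℕ) {x : A} (N : Finset ℕ), cyl i x ∈ F → ∃ k ∉ N, subst i k x ∈ F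

theorem mem_neatReduct {n : ℕ} {x : A} : x ∈ neatReduct A n ↔ ∀ k, n ≤ k → cyl k x = x := by
  constructor
  · intro h k hk
    by_contra hc
    exact (not_lt.2 hk) (h hc)
  · intro h k hk
    by_contra hc
    exact hk (h k (not_lt.1 hc))

theorem IsLocallyFinite.exists_cyl_eq (hlf : IsLocallyFinite ℕ A) (x : A) :
    ∃ N : Finset ℕ, ∀ k ∉ N, cyl k x = x :=
  ⟨(hlf x).toFinset, fun k hk => by simpa [dimSet] using hk⟩

/-- The elements that lie below the translates of some atom of a neat reduct are dense. -/
theorem exists_atom_inf_translate_ne_bot (hlf : IsLocallyFinite ℕ A) (hat : IsNeatlyAtomic A)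
    {n : ℕ} {τ : ℕ → ℕ} (hτ : ∀ i < n, n ≤ τ i) {a : A} (ha : a ≠ ⊥) :
    ∃ x : neatReduct A n, IsAtom x ∧
      ∃ z, IsTranslate (Finset.range n) τ (x : A) z ∧ a ⊓ z ≠ ⊥ := by
  by_contra! hc
  have hτ' : ∀ i ∈ Finset.range n, τ i ∉ Finset.range n := fun i hi => by
    simpa using hτ i (Finset.mem_range.1 hi)
  -- Translates do not depend on indices below `n`, so `a` may be replaced by its closure `b` under
  -- those indices; then `b` stays non-zero on the diagonals.
  obtain ⟨b, hab, hb, -, hb'⟩ := exists_cyl_closed (Finset.range n) a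
  have he : b ⊓ diagInf A (Finset.range n) τ ≠ ⊥ := fun h =>
    ha (le_bot_iff.1 (hab.trans (eq_bot_of_inf_diagInf_eq_bot hτ' hb h).le))
  obtain ⟨N, hN⟩ := hlf.exists_cyl_eq (b ⊓ diagInf A (Finset.range n) τ)
  -- Cylindrifying away all other indices moves this element into the neat `n`-reduct, where an atom
  -- below `e` exists. Disjointness from every translate would force that atom to be disjoint from
  -- `e`.
  obtain ⟨e, hle, he1, he2, he3⟩ :=
    exists_cyl_closed (N \ Finset.range n) (b ⊓ diagInf A (Finset.range n) τ)
  have hen : e ∈ neatReduct A n := mem_neatReduct.2 fun k hk => by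
    by_cases hkN : k ∈ N
    · exact he1 k (by simp [hkN, hk])
    · exact he2 k (hN k hkN)
  have := hat n
  obtain h0 | ⟨x, hx, hxe⟩ := eq_bot_or_exists_atom_le (⟨e, hen⟩ : neatReduct A n)
  · have h0 : e = ⊥ := congrArg Subtype.val h0
    exact he (le_bot_iff.1 (h0 ▸ hle))
  obtain ⟨z, hz, -⟩ := exists_isTranslate hτ' (x : A)
  have h1 := hb' z hz.cyl_eq (hc x hx z hz)
  have h2 : b ⊓ diagInf A (Finset.range n) τ ⊓ (x : A) = ⊥ := by
    rw [inf_assoc, inf_comm _ (x : A), ← hz.inf_eq, ← inf_assoc, h1, bot_inf_eq]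
  have h3 := he3 x (fun k hk => mem_neatReduct.1 x.2 k (by simp at hk; exact hk.2)) h2
  have h4 : (x : A) ≤ e := hxe
  rw [inf_eq_right.2 h4] at h3
  exact hx.1 (Subtype.ext h3)

theorem exists_isHenkin [Countable A] [Nontrivial A] (hlf : IsLocallyFinite ℕ A)
    (hat : IsNeatlyAtomic A) :
    ∃ F : Set A, IsHenkin F ∧ ∀ (n : ℕ) (τ : ℕ → ℕ), (∀ i < n, n ≤ τ i) →
      ∃ x : neatReduct A n, IsAtom x ∧ ∃ z ∈ F, IsTranslate (Finset.range n) τ (x : A) z := by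
  -- Only the first `n` values of `τ` matter, which keeps the family of dense sets countable; the
  -- value 0 beyond them is irrelevant. The three families decide each element, supply witnesses,
  -- and supply atoms.
  let ext : (p : Σ n, Fin n → ℕ) → ℕ → ℕ := fun p i => if h : i < p.1 then p.2 ⟨i, h⟩ else 0
  let D : A ⊕ (ℕ × A × Finset ℕ) ⊕ (Σ n, Fin n → ℕ) → Set A := fun p => match p with
    | .inl x => {a | a ≤ x ∨ a ≤ xᶜ}
    | .inr (.inl (i, x, N)) => {a | a ⊓ cyl i x = ⊥ ∨ ∃ k ∉ N, a ≤ subst i k x}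
    | .inr (.inr p) => {a | (∀ i < p.1, p.1 ≤ ext p i) → ∃ x : neatReduct A p.1, IsAtom x ∧
        ∃ z, a ≤ z ∧ IsTranslate (Finset.range p.1) (ext p) (x : A) z}
  obtain ⟨F, h1, h2, h3, h4⟩ := exists_generic_filter D (by
    rintro (x | ⟨i, x, N⟩ | p) a ha
    · by_cases h : a ⊓ x = ⊥
      · exact ⟨a, Or.inr (le_compl_iff_disjoint_right.2 (disjoint_iff.2 h)), ha, le_rfl⟩
      · exact ⟨a ⊓ x, Or.inl inf_le_right, h, inf_le_left⟩
    · by_cases h : a ⊓ cyl i x = ⊥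
      · exact ⟨a, Or.inl h, ha, le_rfl⟩
      · obtain ⟨N1, hN1⟩ := hlf.exists_cyl_eq a
        obtain ⟨N2, hN2⟩ := hlf.exists_cyl_eq x
        obtain ⟨k, hk⟩ := Infinite.exists_notMem_finset (insert i (N ∪ N1 ∪ N2))
        simp only [Finset.mem_insert, Finset.mem_union, not_or] at hk
        refine ⟨a ⊓ subst i k x, Or.inr ⟨k, hk.2.1.1, inf_le_right⟩, fun h' => h ?_, inf_le_left⟩
        exact inf_cyl_eq_bot_of_inf_subst_eq_bot (Ne.symm hk.1) (hN1 k hk.2.1.2) (hN2 k hk.2.2) h'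
    · by_cases hp : ∀ i < p.1, p.1 ≤ ext p i
      · obtain ⟨x, hx, z, hz, hne⟩ := exists_atom_inf_translate_ne_bot hlf hat hp ha
        exact ⟨a ⊓ z, fun _ => ⟨x, hx, z, inf_le_right, hz⟩, hne, inf_le_left⟩
      · exact ⟨a, fun h => absurd h hp, ha, le_rfl⟩)
  refine ⟨F, ⟨h1, fun hx hy => h2 _ hx _ hy, fun hx hy => h3 _ hx _ hy, ?_, ?_⟩, ?_⟩
  · intro x
    obtain ⟨b, hb, h | h⟩ := h4 (.inl x)
    · exact Or.inl (h3 _ hb _ h)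
    · exact Or.inr (h3 _ hb _ h)
  · intro i x N hx
    obtain ⟨b, hb, h | ⟨k, hk, h⟩⟩ := h4 (.inr (.inl (i, x, N)))
    · exact absurd (h ▸ h2 _ hb _ hx) h1
    · exact ⟨k, hk, h3 _ hb _ h⟩
  · intro n τ hτ
    have hext : ∀ i < n, ext ⟨n, fun i => τ i⟩ i = τ i := fun i hi => by simp [ext, hi]
    obtain ⟨b, hb, h⟩ := h4 (.inr (.inr ⟨n, fun i => τ i⟩))
    obtain ⟨x, hx, z, hbz, hz⟩ := h fun i hi => (hext i hi).symm ▸ hτ i hi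
    exact ⟨x, hx, z, h3 _ hb _ hbz, hz.congr fun i hi => hext i (Finset.mem_range.1 hi)⟩

/-! ### Locality of the interior operators. -/

theorem cyl_univ_iff_le_int (i : ℕ) (x y : A) :
    univ i ((xᶜ ⊔ y) ⊓ (yᶜ ⊔ x)) ≤ (int i x)ᶜ ⊔ int i y :=
  (univ_iff_le i x y).trans ((univ_le i _).trans inf_le_left)

/-- An element `d` independent of `i` lies below the biconditional of `x` and `y` only if it lies
below its universal closure, to which the first interior axiom applies. -/
theorem inf_int_le_of_inf_le {i : ℕ} {d x y : A} (hd : cyl i d = d) (h : d ⊓ x = d ⊓ y) :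
    d ⊓ int i x ≤ int i y := by
  have h1 : d ≤ univ i ((xᶜ ⊔ y) ⊓ (yᶜ ⊔ x)) := by
    rw [le_univ_iff hd]
    refine le_inf ?_ ?_
    · rw [sup_comm, ← himp_eq, le_himp_iff, h]
      exact inf_le_right
    · rw [sup_comm, ← himp_eq, le_himp_iff, ← h]
      exact inf_le_right
  rw [← le_himp_iff, himp_eq, sup_comm]
  exact h1.trans (cyl_univ_iff_le_int i x y)

theorem inf_int_congr {i : ℕ} {d x y : A} (hd : cyl i d = d) (h : d ⊓ x = d ⊓ y) :
    d ⊓ int i x = d ⊓ int i y :=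
  le_antisymm (le_inf inf_le_left (inf_int_le_of_inf_le hd h))
    (le_inf inf_le_left (inf_int_le_of_inf_le hd h.symm))

theorem cyl_int_of_ne {i k : ℕ} {x : A} (h : k ≠ i) (hx : cyl k x = x) :
    cyl k (int i x) = int i x :=
  cyl_int i k x h fun h' => h' hx

theorem _root_.CylindricAlgebra.IsTranslate.int {J : Finset ℕ} {τ : ℕ → ℕ} {x z : A} (h : IsTranslate J τ x z) {i : ℕ}
    (hi : i ∉ J) (hτ : ∀ j ∈ J, τ j ≠ i) : IsTranslate J τ (int i x) (int i z) where
  cyl_eq j hj := cyl_int_of_ne (fun h' : j = i => hi (h' ▸ hj)) (h.cyl_eq j hj)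
  inf_eq := by
    rw [inf_comm, inf_comm (TopCylindricAlgebra.int i x)]
    refine inf_int_congr (cyl_diagInf hi hτ) ?_
    rw [inf_comm, h.inf_eq, inf_comm]

/-! ### The base and the representation attached to a Henkin ultrafilter. -/

namespace IsHenkin

variable {F : Set A} (hF : IsHenkin F)

include hF

theorem top_mem : ⊤ ∈ F := by
  obtain h | h := hF.mem_or_compl_mem ⊥
  · exact absurd h hF.bot_notMem
  · simpa using h

theorem compl_mem_iff {x : A} : xᶜ ∈ F ↔ x ∉ F := by
  constructor
  · intro h h'
    have := hF.inf_mem h h'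
    rw [compl_inf_eq_bot] at this
    exact hF.bot_notMem this
  · exact (hF.mem_or_compl_mem x).resolve_left

theorem inf_mem_iff {x y : A} : x ⊓ y ∈ F ↔ x ∈ F ∧ y ∈ F :=
  ⟨fun h => ⟨hF.mem_of_le h inf_le_left, hF.mem_of_le h inf_le_right⟩, fun h => hF.inf_mem h.1 h.2⟩

/-- Indices are equivalent if the corresponding diagonal element belongs to `F`. -/
def setoid : Setoid ℕ where
  r i j := diag i j ∈ F
  iseqv :=
    { refl := fun i => by rw [diag_self]; exact hF.top_mem
      symm := fun h => by rwa [diag_comm]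
      trans := fun h h' => hF.mem_of_le (hF.inf_mem h h') (diag_trans _ _ _) }

/-- The base of the representation given by `F`. -/
def Base : Type := Quotient hF.setoid

/-- The element of the base named by the index `i`. -/
def pt (i : ℕ) : hF.Base := Quotient.mk hF.setoid i

theorem pt_eq_pt {i j : ℕ} : hF.pt i = hF.pt j ↔ diag i j ∈ F := Quotient.eq (r := hF.setoid)

/-- Since `cyl j (diag j i) = ⊤` is in `F`, it has a witness outside any finite set: every point has
infinitely many names, so clashes can always be avoided. -/
theorem exists_pt_eq (a : hF.Base) (N : Finset ℕ) : ∃ k ∉ N, hF.pt k = a := by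
  obtain ⟨i, rfl⟩ := Quotient.exists_rep a
  obtain ⟨j, hj⟩ := Infinite.exists_notMem_finset {i}
  have hji : j ≠ i := by simpa using hj
  have h1 : cyl j (diag j i : A) ∈ F := by rw [cyl_diag hji]; exact hF.top_mem
  obtain ⟨k, hk, hkF⟩ := hF.exists_subst_mem j (insert j N) h1
  simp only [Finset.mem_insert, not_or] at hk
  refine ⟨k, hk.2, hF.pt_eq_pt.2 (hF.mem_of_le hkF ?_)⟩
  rw [subst, cyl_le_iff (cyl_diag_of_ne (Ne.symm hk.1) hji), diag_comm j k]
  exact diag_trans k j i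

theorem exists_section (s : ℕ → hF.Base) (N : Finset ℕ) :
    ∃ τ : ℕ → ℕ, ∀ i, τ i ∉ N ∧ hF.pt (τ i) = s i := by
  choose τ h using fun i => hF.exists_pt_eq (s i) N
  exact ⟨τ, h⟩

theorem finset_inf_mem {J : Finset ℕ} {g : ℕ → A} (h : ∀ i ∈ J, g i ∈ F) : J.inf g ∈ F :=
  Finset.inf_induction (p := (· ∈ F)) hF.top_mem (fun _ hx _ hy => hF.inf_mem hx hy) h

/-- Let `E ∈ F` say that the two systems of names agree. Then `z ⊓ wᶜ ⊓ E` is independent of `J`,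
and on the diagonals of `τ` it lies below `x ⊓ xᶜ`; hence it is `⊥`. -/
theorem mem_of_isTranslate {J : Finset ℕ} {τ σ : ℕ → ℕ} {x z w : A} (hτ : ∀ i ∈ J, τ i ∉ J)
    (hσ : ∀ i ∈ J, σ i ∉ J) (h : ∀ i ∈ J, hF.pt (τ i) = hF.pt (σ i))
    (hz : IsTranslate J τ x z) (hw : IsTranslate J σ x w) (hzF : z ∈ F) : w ∈ F := by
  by_contra hwF
  have hE := hF.finset_inf_mem fun i hi => hF.pt_eq_pt.1 (h i hi)
  set E : A := J.inf fun i => diag (τ i) (σ i) with hEdef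
  have hEJ : ∀ j ∈ J, cyl j E = E := fun j hj =>
    Finset.inf_induction (p := fun e : A => cyl j e = e) (cyl_top j)
      (fun _ h _ h' => cyl_inf_eq h h') fun i hi => cyl_diag_of_ne
        (fun h' : j = τ i => hτ i hi (h' ▸ hj)) (fun h' : j = σ i => hσ i hi (h' ▸ hj))
  have hED : E ⊓ diagInf A J τ ≤ diagInf A J σ := Finset.le_inf fun i hi => by
    refine le_trans ?_ (diag_trans i (τ i) (σ i))
    exact le_inf (inf_le_right.trans (diagInf_le hi)) (inf_le_left.trans (Finset.inf_le hi))
  have hmem := hF.inf_mem (hF.inf_mem hzF (hF.compl_mem_iff.2 hwF)) hE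
  rw [eq_bot_of_inf_diagInf_eq_bot hτ (x := z ⊓ wᶜ ⊓ E) (fun i hi => cyl_inf_eq
    (cyl_inf_eq (hz.cyl_eq i hi) (cyl_compl_eq (hw.cyl_eq i hi))) (hEJ i hi)) ?_] at hmem
  · exact hF.bot_notMem hmem
  rw [← le_bot_iff, ← inf_compl_eq_bot (a := x)]
  refine le_inf ?_ ?_
  · refine le_trans (le_trans (inf_le_inf_right _ ?_) hz.inf_eq.le) inf_le_left
    exact inf_le_left.trans inf_le_left
  · rw [inf_assoc]
    refine le_trans (le_trans (inf_le_inf inf_le_right hED) hw.compl.inf_eq.le) inf_le_left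

/-- The representation of `A` given by `F`. -/
def rep (x : A) : Set (ℕ → hF.Base) :=
  {s | ∃ (J : Finset ℕ) (τ : ℕ → ℕ) (z : A), (∀ k ∉ J, cyl k x = x) ∧ (∀ i ∈ J, τ i ∉ J) ∧
    (∀ i ∈ J, hF.pt (τ i) = s i) ∧ IsTranslate J τ x z ∧ z ∈ F}

/-- Two choices of data are compared through names `ρ` avoiding both `J` and `K`: translates over
`J` and over `K` along `ρ` are then both translates over `J ∪ K`, because `x` depends on nothing
outside either set. -/
theorem mem_rep_iff {x : A} {s : ℕ → hF.Base} {J : Finset ℕ} {τ : ℕ → ℕ} {z : A}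
    (hx : ∀ k ∉ J, cyl k x = x) (hτ : ∀ i ∈ J, τ i ∉ J) (hs : ∀ i ∈ J, hF.pt (τ i) = s i)
    (hz : IsTranslate J τ x z) : s ∈ hF.rep x ↔ z ∈ F := by
  refine ⟨?_, fun h => ⟨J, τ, z, hx, hτ, hs, hz, h⟩⟩
  rintro ⟨K, σ, w, hx', hσ, hs', hw, hwF⟩
  obtain ⟨ρ, hρ⟩ := hF.exists_section s (J ∪ K)
  simp only [Finset.mem_union, not_or] at hρ
  have hρJ : ∀ i ∈ J, ρ i ∉ J := fun i _ => (hρ i).1.1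
  have hρK : ∀ i ∈ K, ρ i ∉ K := fun i _ => (hρ i).1.2
  obtain ⟨z', hz', hz''⟩ := exists_isTranslate hρJ x
  obtain ⟨w', hw', hw''⟩ := exists_isTranslate hρK x
  have hwF' : w' ∈ F := hF.mem_of_isTranslate hσ hρK
    (fun i hi => (hs' i hi).trans (hρ i).2.symm) hw hw' hwF
  have hz2 : IsTranslate (J ∪ K) ρ x z' := by
    refine ⟨fun i hi => hz'' i (fun j _ h => ?_) (hx i), ?_⟩
    · obtain hi | hi := Finset.mem_union.1 hi
      · exact (hρ j).1.1 (h ▸ hi)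
      · exact (hρ j).1.2 (h ▸ hi)
    · rw [← inf_eq_right.2 (diagInf_anti Finset.subset_union_left ρ), ← inf_assoc, hz'.inf_eq,
        inf_assoc]
  have hw2 : IsTranslate (J ∪ K) ρ x w' := by
    refine ⟨fun i hi => hw'' i (fun j _ h => ?_) (hx' i), ?_⟩
    · obtain hi | hi := Finset.mem_union.1 hi
      · exact (hρ j).1.1 (h ▸ hi)
      · exact (hρ j).1.2 (h ▸ hi)
    · rw [← inf_eq_right.2 (diagInf_anti Finset.subset_union_right ρ), ← inf_assoc, hw'.inf_eq,
        inf_assoc]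
  have hρJK : ∀ i ∈ J ∪ K, ρ i ∉ J ∪ K := fun i _ => by
    simpa only [Finset.mem_union, not_or] using (hρ i).1
  exact hF.mem_of_isTranslate hρJ hτ (fun i hi => (hρ i).2.trans (hs i hi).symm) hz' hz
    (hF.mem_of_isTranslate hρJK hρJK (fun _ _ => rfl) hw2 hz2 hwF')

theorem subst_mem_congr {i k l : ℕ} (hk : i ≠ k) (hl : i ≠ l) (x : A)
    (h : hF.pt k = hF.pt l) : subst i k x ∈ F ↔ subst i l x ∈ F :=
  ⟨fun hx => hF.mem_of_le (hF.inf_mem hx (hF.pt_eq_pt.1 h)) (subst_inf_diag_le hk hl x),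
    fun hx => hF.mem_of_le (hF.inf_mem hx (hF.pt_eq_pt.1 h.symm)) (subst_inf_diag_le hl hk x)⟩

/-! ### The representation preserves the cylindric operations. -/

section Hom

variable (hlf : IsLocallyFinite ℕ A)
include hlf

theorem rep_compl (x : A) : hF.rep xᶜ = (hF.rep x)ᶜ := by
  ext s
  obtain ⟨J, hJ⟩ := hlf.exists_cyl_eq x
  obtain ⟨τ, hτ⟩ := hF.exists_section s J
  have h1 : ∀ i ∈ J, τ i ∉ J := fun i _ => (hτ i).1
  obtain ⟨z, hz, -⟩ := exists_isTranslate h1 x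
  rw [Set.mem_compl_iff, hF.mem_rep_iff hJ h1 (fun i _ => (hτ i).2) hz,
    hF.mem_rep_iff (fun k hk => cyl_compl_eq (hJ k hk)) h1 (fun i _ => (hτ i).2) hz.compl,
    hF.compl_mem_iff]

theorem rep_inf (x y : A) : hF.rep (x ⊓ y) = hF.rep x ⊓ hF.rep y := by
  ext s
  obtain ⟨J₁, hJ₁⟩ := hlf.exists_cyl_eq x
  obtain ⟨J₂, hJ₂⟩ := hlf.exists_cyl_eq y
  obtain ⟨τ, hτ⟩ := hF.exists_section s (J₁ ∪ J₂)
  have h1 : ∀ i ∈ J₁ ∪ J₂, τ i ∉ J₁ ∪ J₂ := fun i _ => (hτ i).1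
  obtain ⟨z, hz, -⟩ := exists_isTranslate h1 x
  obtain ⟨w, hw, -⟩ := exists_isTranslate h1 y
  have hx : ∀ k ∉ J₁ ∪ J₂, cyl k x = x := fun k hk =>
    hJ₁ k fun h => hk (Finset.mem_union_left _ h)
  have hy : ∀ k ∉ J₁ ∪ J₂, cyl k y = y := fun k hk =>
    hJ₂ k fun h => hk (Finset.mem_union_right _ h)
  change _ ↔ s ∈ hF.rep x ∧ s ∈ hF.rep y
  rw [hF.mem_rep_iff hx h1 (fun i _ => (hτ i).2) hz,
    hF.mem_rep_iff hy h1 (fun i _ => (hτ i).2) hw,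
    hF.mem_rep_iff (fun k hk => cyl_inf_eq (hx k hk) (hy k hk)) h1 (fun i _ => (hτ i).2)
      (hz.inf hw), hF.inf_mem_iff]

theorem rep_sup (x y : A) : hF.rep (x ⊔ y) = hF.rep x ⊔ hF.rep y := by
  rw [← compl_inj_iff, compl_sup, ← hF.rep_compl hlf, ← hF.rep_compl hlf, ← hF.rep_compl hlf,
    compl_sup, hF.rep_inf hlf]

omit hlf in
theorem rep_bot : hF.rep ⊥ = ⊥ := by
  ext s
  simp only [Set.bot_eq_empty, Set.mem_empty_iff_false, iff_false]
  rw [hF.mem_rep_iff (J := ∅) (τ := id) (fun k _ => cyl_bot k) (by simp) (by simp)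
    IsTranslate.bot]
  exact hF.bot_notMem

theorem rep_top : hF.rep ⊤ = ⊤ := by
  rw [← compl_bot, hF.rep_compl hlf, hF.rep_bot, compl_bot]

omit hlf in
theorem rep_diag (i j : ℕ) : hF.rep (diag i j) = diag i j := by
  ext s
  obtain ⟨τ, hτ⟩ := hF.exists_section s {i, j}
  have h1 : ∀ k ∈ ({i, j} : Finset ℕ), τ k ∉ ({i, j} : Finset ℕ) := fun i _ => (hτ i).1
  rw [hF.mem_rep_iff (J := {i, j}) (fun k hk => ?_) h1 (fun i _ => (hτ i).2)
    (IsTranslate.diag h1 (by simp) (by simp)), ← hF.pt_eq_pt, (hτ i).2, (hτ j).2]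
  · rfl
  · simp only [Finset.mem_insert, Finset.mem_singleton, not_or] at hk
    exact cyl_diag_of_ne hk.1 hk.2

/-- The section of `hF.rep x` through `s` in direction `i` is defined by a translate of `x`. -/
theorem exists_translate_section (s : ℕ → hF.Base) (i : ℕ) (x : A) :
    ∃ (N : Finset ℕ) (z : A), i ∈ N ∧
      (∀ k ∉ N, Function.update s i (hF.pt k) ∈ hF.rep x ↔ subst i k z ∈ F) ∧
      (∀ k ∉ N, Function.update s i (hF.pt k) ∈ hF.rep (cyl i x) ↔ subst i k (cyl i z) ∈ F) ∧
      (∀ k ∉ N, Function.update s i (hF.pt k) ∈ hF.rep (int i x) ↔ subst i k (int i z) ∈ F) := by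
  obtain ⟨N, hN⟩ := hlf.exists_cyl_eq x
  obtain ⟨τ, hτ⟩ := hF.exists_section s (insert i N)
  have hi : i ∉ N.erase i := Finset.notMem_erase i N
  have hins : insert i (N.erase i) = insert i N := by ext; simp; tauto
  -- Every coordinate except `i` is replaced by a name, and no name is `i`. So `i` stays free in
  -- `z`, and `subst i k` completes the translation at the point named `k`.
  have h1 : ∀ j ∈ N.erase i, τ j ∉ N.erase i := fun j _ h =>
    (hτ j).1 (Finset.mem_insert_of_mem (Finset.mem_of_mem_erase h))
  have h2 : ∀ j ∈ N.erase i, τ j ≠ i := fun j _ h => (hτ j).1 (h ▸ Finset.mem_insert_self _ _)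
  obtain ⟨z, hz, -⟩ := exists_isTranslate h1 x
  have key : ∀ {y w : A}, (∀ k ∉ insert i N, cyl k y = y) → IsTranslate (N.erase i) τ y w →
      ∀ k ∉ insert i N, Function.update s i (hF.pt k) ∈ hF.rep y ↔ subst i k w ∈ F := by
    intro y w hy hw k hk
    have h3 := hw.subst hi (hins ▸ hk)
    rw [hins] at h3
    refine hF.mem_rep_iff hy (fun j _ => ?_) (fun j _ => ?_) h3
    · by_cases hj : j = i
      · subst hj
        rwa [Function.update_self]
      · rw [Function.update_of_ne hj]
        exact (hτ j).1
    · by_cases hj : j = i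
      · subst hj
        simp
      · rw [Function.update_of_ne hj, Function.update_of_ne hj]
        exact (hτ j).2
  have hx : ∀ k ∉ insert i N, k ≠ i ∧ cyl k x = x := fun k hk => by
    simp only [Finset.mem_insert, not_or] at hk
    exact ⟨hk.1, hN k hk.2⟩
  exact ⟨insert i N, z, Finset.mem_insert_self _ _, key (fun k hk => (hx k hk).2) hz,
    key (fun k hk => cyl_cyl_eq i (hx k hk).2) (hz.cyl hi h2),
    key (fun k hk => cyl_int_of_ne (hx k hk).1 (hx k hk).2) (hz.int hi h2)⟩

theorem rep_cyl (i : ℕ) (x : A) : hF.rep (cyl i x) = cyl i (hF.rep x) := by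
  ext s
  change _ ↔ s ∈ setCyl i _
  rw [mem_setCyl]
  obtain ⟨N, z, hi, h1, h2, -⟩ := hF.exists_translate_section hlf s i x
  obtain ⟨k, hk, hks⟩ := hF.exists_pt_eq (s i) N
  have hik : i ≠ k := fun h => hk (h ▸ hi)
  have h3 := h2 k hk
  rw [hks, Function.update_eq_self, subst_eq_self hik (cyl_cyl i z)] at h3
  rw [h3]
  constructor
  · intro h
    obtain ⟨l, hl, hlF⟩ := hF.exists_subst_mem i N h
    exact ⟨hF.pt l, (h1 l hl).2 hlF⟩
  · rintro ⟨a, ha⟩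
    obtain ⟨l, hl, rfl⟩ := hF.exists_pt_eq a N
    exact hF.mem_of_le ((h1 l hl).1 ha) (subst_le_cyl i l z)

end Hom

end IsHenkin

/-! ### The topology on the base and preservation of interiors. -/

namespace IsHenkin

variable {F : Set A} (hF : IsHenkin F)

/-- The subset of the base defined by `int i z`, with the indices other than `i` as parameters. -/
def openSet (i : ℕ) (z : A) : Set hF.Base :=
  {a | ∃ k, i ≠ k ∧ hF.pt k = a ∧ subst i k (int i z) ∈ F}

theorem pt_mem_openSet {i k : ℕ} (hk : i ≠ k) {z : A} :
    hF.pt k ∈ hF.openSet i z ↔ subst i k (int i z) ∈ F := by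
  refine ⟨?_, fun h => ⟨k, hk, rfl, h⟩⟩
  rintro ⟨l, hl, h, hlF⟩
  exact (hF.subst_mem_congr hl hk _ h).1 hlF

theorem openSet_inter (i : ℕ) (z w : A) :
    hF.openSet i z ∩ hF.openSet i w = hF.openSet i (z ⊓ w) := by
  ext a
  obtain ⟨k, hk, rfl⟩ := hF.exists_pt_eq a {i}
  have hik : i ≠ k := by simpa [eq_comm] using hk
  rw [Set.mem_inter_iff, hF.pt_mem_openSet hik, hF.pt_mem_openSet hik, hF.pt_mem_openSet hik,
    ← int_inf, subst_inf hik, hF.inf_mem_iff]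

theorem openSet_top (i : ℕ) : hF.openSet i ⊤ = Set.univ := by
  refine Set.eq_univ_of_forall fun a => ?_
  obtain ⟨k, hk, rfl⟩ := hF.exists_pt_eq a {i}
  have hik : i ≠ k := by simpa [eq_comm] using hk
  rw [hF.pt_mem_openSet hik, int_top, subst_top hik]
  exact hF.top_mem

/-- Renaming the bound index, by the axiom `subst_int`. It lets two basic open sets be defined in
one common direction. -/
theorem openSet_subst {i m : ℕ} {z : A} (him : i ≠ m) (hz : cyl m z = z) :
    hF.openSet m (subst i m z) = hF.openSet i z := by
  ext a
  obtain ⟨k, hk, rfl⟩ := hF.exists_pt_eq a {i, m}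
  simp only [Finset.mem_insert, Finset.mem_singleton, not_or] at hk
  rw [hF.pt_mem_openSet (Ne.symm hk.2), hF.pt_mem_openSet (Ne.symm hk.1),
    ← subst_int i m z fun h => h hz,
    subst_subst him (Ne.symm hk.1) (Ne.symm hk.2) (cyl_int_of_ne him.symm hz)]

/-- If `v`, the universal closure of "`int m w` implies `z`", were not in `F`, a Henkin witness
outside `N` would contradict `h`. As `v` is independent of `m`, locality and idempotence of the
interior upgrade `v ⊓ int m w ≤ z` to `v ⊓ int m w ≤ int m z`. -/
theorem openSet_subset {m : ℕ} {w z : A} (N : Finset ℕ)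
    (h : ∀ k ∉ N, hF.pt k ∈ hF.openSet m w → subst m k z ∈ F) :
    hF.openSet m w ⊆ hF.openSet m z := by
  have hv : univ m ((int m w)ᶜ ⊔ z) ∈ F := by
    rw [univ, hF.compl_mem_iff]
    intro hc
    obtain ⟨k, hk, hkF⟩ := hF.exists_subst_mem m (insert m N) hc
    simp only [Finset.mem_insert, not_or] at hk
    have hmk : m ≠ k := Ne.symm hk.1
    rw [compl_sup, compl_compl, subst_inf hmk, subst_compl hmk, hF.inf_mem_iff,
      hF.compl_mem_iff] at hkF
    exact hkF.2 (h k hk.2 ((hF.pt_mem_openSet hmk).2 hkF.1))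
  set v := univ m ((int m w)ᶜ ⊔ z)
  have hvm : cyl m v = v := cyl_univ m _
  have h1 : v ⊓ int m w ≤ z := by
    rw [← le_himp_iff, himp_eq, sup_comm]
    exact univ_le m _
  have h2 : v ⊓ int m w ≤ int m z := by
    refine le_trans (inf_le_inf_left v (int_le_int_int m w)) ?_
    refine le_trans (inf_int_le_of_inf_le (y := int m w ⊓ z) hvm ?_) ?_
    · rw [← inf_assoc, inf_eq_left.2 h1]
    · rw [← int_inf]
      exact inf_le_right
  rintro _ ⟨k, hk, rfl, hkF⟩
  rw [hF.pt_mem_openSet hk]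
  refine hF.mem_of_le ?_ (subst_mono m k h2)
  rw [subst_inf hk, subst_eq_self hk hvm]
  exact hF.inf_mem hv hkF

instance : TopologicalSpace hF.Base :=
  TopologicalSpace.generateFrom {U | ∃ i z, U = hF.openSet i z}

theorem exists_openSet_eq (hlf : IsLocallyFinite ℕ A) (i j : ℕ) (z w : A) :
    ∃ (m : ℕ) (z' w' : A), hF.openSet i z = hF.openSet m z' ∧ hF.openSet j w = hF.openSet m w' ∧
      ∀ k, i ≠ k → m ≠ k → subst m k z' = subst i k z := by
  obtain ⟨N₁, h₁⟩ := hlf.exists_cyl_eq z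
  obtain ⟨N₂, h₂⟩ := hlf.exists_cyl_eq w
  obtain ⟨m, hm⟩ := Infinite.exists_notMem_finset (insert i (insert j (N₁ ∪ N₂)))
  simp only [Finset.mem_insert, Finset.mem_union, not_or] at hm
  obtain ⟨hmi, hmj, hm₁, hm₂⟩ := hm
  exact ⟨m, subst i m z, subst j m w, (hF.openSet_subst (Ne.symm hmi) (h₁ m hm₁)).symm,
    (hF.openSet_subst (Ne.symm hmj) (h₂ m hm₂)).symm,
    fun k hik hmk => subst_subst (Ne.symm hmi) hik hmk (h₁ m hm₁)⟩

theorem isTopologicalBasis_openSet (hlf : IsLocallyFinite ℕ A) :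
    TopologicalSpace.IsTopologicalBasis {U | ∃ i z, U = hF.openSet i z} where
  exists_subset_inter := by
    rintro _ ⟨i, z, rfl⟩ _ ⟨j, w, rfl⟩ a ha
    obtain ⟨m, z', w', hz, hw, -⟩ := hF.exists_openSet_eq hlf i j z w
    rw [hz, hw, hF.openSet_inter] at ha ⊢
    exact ⟨_, ⟨m, _, rfl⟩, ha, subset_rfl⟩
  sUnion_eq := Set.eq_univ_of_forall fun a =>
    ⟨Set.univ, ⟨0, ⊤, (hF.openSet_top 0).symm⟩, Set.mem_univ a⟩
  eq_generateFrom := rfl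

theorem rep_int (hlf : IsLocallyFinite ℕ A) (i : ℕ) (x : A) :
    hF.rep (int i x) = int i (hF.rep x) := by
  ext s
  change _ ↔ s ∈ setInt i _
  rw [mem_setInt]
  obtain ⟨N, z, hi, h1, -, h2⟩ := hF.exists_translate_section hlf s i x
  have hik : ∀ k ∉ N, i ≠ k := fun k hk h => hk (h ▸ hi)
  have h3 : ∀ a, Function.update s i a ∈ hF.rep (int i x) ↔ a ∈ hF.openSet i z := by
    intro a
    obtain ⟨k, hk, rfl⟩ := hF.exists_pt_eq a N
    rw [h2 k hk, hF.pt_mem_openSet (hik k hk)]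
  have h4 := h3 (s i)
  rw [Function.update_eq_self] at h4
  rw [h4, mem_interior_iff_mem_nhds, (hF.isTopologicalBasis_openSet hlf).mem_nhds_iff]
  constructor
  · refine fun h => ⟨_, ⟨i, z, rfl⟩, h, fun a ha => ?_⟩
    obtain ⟨k, hk, rfl⟩ := hF.exists_pt_eq a N
    rw [hF.pt_mem_openSet (hik k hk)] at ha
    exact (h1 k hk).2 (hF.mem_of_le ha (subst_mono i k (int_le i z)))
  -- A basic neighbourhood may use another direction `j` and other parameters, so both sets are
  -- first moved to a fresh direction `m`.
  · rintro ⟨_, ⟨j, w, rfl⟩, hs, hsub⟩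
    obtain ⟨m, z', w', hz, hw, hzz⟩ := hF.exists_openSet_eq hlf i j z w
    rw [hz]
    rw [hw] at hs hsub
    refine hF.openSet_subset (insert m N) (fun k hk hkw => ?_) hs
    simp only [Finset.mem_insert, not_or] at hk
    rw [hzz k (hik k hk.2) (Ne.symm hk.1)]
    exact (h1 k hk.2).1 (hsub hkw)

theorem isHom_rep (hlf : IsLocallyFinite ℕ A) : IsHom ℕ hF.rep where
  map_sup := hF.rep_sup hlf
  map_inf := hF.rep_inf hlf
  map_compl := hF.rep_compl hlf
  map_bot := hF.rep_bot
  map_top := hF.rep_top hlf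
  map_cyl := hF.rep_cyl hlf
  map_diag := hF.rep_diag
  map_int := hF.rep_int hlf

end IsHenkin

/-! ### Injectivity from simplicity, and assembly of the theorem. -/

section Hom

variable {B : Type*} [BooleanAlgebra B] [TopCylindricAlgebra ℕ B] {f : A → B}

/-- A homomorphism from a simple algebra to a nontrivial one is injective. -/
theorem IsHom.injective [Nontrivial B] (hf : IsHom ℕ f) (hs : IsSimple ℕ A) :
    Function.Injective f := by
  obtain h | h := hs.2 (Setoid.ker f)
    { sup := fun {x x' y y'} (h : f x = f x') (h' : f y = f y') => by
        change f _ = f _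
        rw [hf.map_sup, hf.map_sup, h, h']
      inf := fun {x x' y y'} (h : f x = f x') (h' : f y = f y') => by
        change f _ = f _
        rw [hf.map_inf, hf.map_inf, h, h']
      compl := fun {x x'} (h : f x = f x') => by
        change f _ = f _
        rw [hf.map_compl, hf.map_compl, h]
      cyl := fun i {x x'} (h : f x = f x') => by
        change f _ = f _
        rw [hf.map_cyl, hf.map_cyl, h]
      int := fun i {x x'} (h : f x = f x') => by
        change f _ = f _
        rw [hf.map_int, hf.map_int, h] }
  · exact Setoid.ker_eq_bot_iff.1 h
  · have h1 : Setoid.ker f ⊥ ⊤ := by rw [h]; trivial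
    have h1 : f ⊥ = f ⊤ := h1
    rw [hf.map_bot, hf.map_top] at h1
    exact absurd h1 bot_ne_top

/-- The range of a homomorphism into a full set algebra is a set algebra. -/
def IsHom.range {U : Type*} [TopologicalSpace U] {f : A → Set (ℕ → U)} (hf : IsHom ℕ f) :
    SetAlgebra ℕ U where
  carrier := Set.range f
  supClosed' := by
    rintro _ ⟨x, rfl⟩ _ ⟨y, rfl⟩
    exact ⟨_, hf.map_sup x y⟩
  infClosed' := by
    rintro _ ⟨x, rfl⟩ _ ⟨y, rfl⟩
    exact ⟨_, hf.map_inf x y⟩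
  compl_mem' := by
    rintro _ ⟨x, rfl⟩
    exact ⟨_, hf.map_compl x⟩
  bot_mem' := ⟨_, hf.map_bot⟩
  cyl_mem := by
    rintro i _ ⟨x, rfl⟩
    exact ⟨_, hf.map_cyl i x⟩
  diag_mem i j := ⟨_, hf.map_diag i j⟩
  int_mem := by
    rintro i _ ⟨x, rfl⟩
    exact ⟨_, hf.map_int i x⟩

end Hom

theorem exists_isAtomicRepresentation [Countable A] (hlf : IsLocallyFinite ℕ A)
    (hsimple : IsSimple ℕ A) (hatomic : IsNeatlyAtomic A) :
    ∃ (U : Type) (_ : Nonempty U) (_ : TopologicalSpace U) (B : SetAlgebra ℕ U)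
      (f : A → Set (ℕ → U)), IsAtomicRepresentation B f := by
  have := hsimple.1
  obtain ⟨F, hF, hFat⟩ := exists_isHenkin hlf hatomic
  have hne : Nonempty hF.Base := ⟨hF.pt 0⟩
  have hhom := hF.isHom_rep hlf
  refine ⟨hF.Base, hne, inferInstance, hhom.range, hF.rep,
    { isHom := hhom
      injective := hhom.injective hsimple
      range_eq := rfl
      iUnion_atoms := fun n => Set.eq_univ_of_forall fun s => ?_ }⟩
  obtain ⟨τ, hτ⟩ := hF.exists_section s (Finset.range n)
  obtain ⟨x, hx, z, hz, hxz⟩ := hFat n τ fun i _ => by simpa using (hτ i).1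
  refine Set.mem_biUnion (x := x) hx ?_
  exact (hF.mem_rep_iff (fun k hk => mem_neatReduct.1 x.2 k (by simpa using hk))
    (fun i _ => (hτ i).1) (fun i _ => (hτ i).2) hxz).2 hz

theorem IsAtomicRepresentation.omits {U : Type*} [TopologicalSpace U] {B : SetAlgebra ℕ U}
    {f : A → Set (ℕ → U)} (hf : IsAtomicRepresentation B f) {Y : Set A} (hY : IsFinitaryType Y)
    (hY' : IsNonPrincipal Y) : Omits f Y := by
  obtain ⟨n, hn⟩ := hY
  refine Set.eq_empty_of_forall_notMem fun s hs => ?_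
  have hs' : s ∈ ⋃ x ∈ {x : neatReduct A n | IsAtom x}, f x := hf.iUnion_atoms n ▸ Set.mem_univ s
  simp only [Set.mem_iUnion] at hs' hs
  obtain ⟨x, hx, hsx⟩ := hs'
  have hx : IsAtom x := hx
  -- The atom `x` is either below `y` or disjoint from it, and `s` lies in both images, which
  -- excludes disjointness.
  have hle : (x : A) ≤ ⊥ := hY'.2 fun y hy => by
    obtain h | h := hx.le_iff.1 (inf_le_left : x ⊓ ⟨y, hn hy⟩ ≤ x)
    · have h1 : (x : A) ⊓ y = ⊥ := congrArg Subtype.val h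
      have h2 : s ∈ f ((x : A) ⊓ y) := by
        rw [hf.isHom.map_inf]
        exact ⟨hsx, Set.mem_iInter₂.1 (by simpa using hs) y hy⟩
      rw [h1, hf.isHom.map_bot] at h2
      exact absurd h2 (Set.notMem_empty s)
    · have h1 : (x : A) ⊓ y = x := congrArg Subtype.val h
      exact inf_eq_left.1 h1
  exact hx.1 (Subtype.ext (le_bot_iff.1 hle))

end TopCylindricAlgebra

theorem mainTheorem9 {A : Type*} [BooleanAlgebra A] [TopCylindricAlgebra ℕ A] [Countable A]
    (hlf : TopCylindricAlgebra.IsLocallyFinite ℕ A)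
    (hsimple : TopCylindricAlgebra.IsSimple ℕ A)
    (hatomic : TopCylindricAlgebra.IsNeatlyAtomic A) :
    (∃ (U : Type) (_ : Nonempty U) (_ : TopologicalSpace U)
        (B : TopCylindricAlgebra.SetAlgebra ℕ U) (f : A → Set (ℕ → U)),
        TopCylindricAlgebra.IsAtomicRepresentation B f) ∧
      ∀ (U : Type*) [TopologicalSpace U]
        (B : TopCylindricAlgebra.SetAlgebra ℕ U) (f : A → Set (ℕ → U)),
        TopCylindricAlgebra.IsAtomicRepresentation B f →
          ∀ Y : Set A, TopCylindricAlgebra.IsFinitaryType Y →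
            TopCylindricAlgebra.IsNonPrincipal Y → TopCylindricAlgebra.Omits f Y := by
  exact ⟨TopCylindricAlgebra.exists_isAtomicRepresentation hlf hsimple hatomic,
    fun U _ B f hf Y hY hY' => hf.omits hY hY'⟩
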